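/- Let $\Bbbk$ be a field, $n\ge 2$, and let $\mathbf p=(p_{ij})\in M_n(\Bbbk^\times)$ satisfy $p_{ii}=1$ and $p_{ij}=p_{ji}^{-1}$ for all $i,j$, with every $p_{ij}$ a root of unity. Let $A=\Bbbk_{\mathbf p}[x_1,\dots,x_n]$ be the skew polynomial ring, i.e. the $\Bbbk$-algebra generated by $x_1,\dots,x_n$ subject to the relations $x_jx_i=p_{ij}x_ix_j$ for $1\le i<j\le n$, and let $Z$ be the center of $A$. Let $F$ be the fraction field of $Z$, let $\operatorname{tr}\colon A\to F$ be the regular trace, sending $a$ to the trace of left multiplication by $a$ on $A\otimes_Z F$, and let $w=\dim_F(A\otimes_Z F)$ be the rank of $A$ over $Z$. For a positive integer $v$, let $MD_v(A/Z)$ be the ideal of $Z$ generated by all elements $\det\big(\operatorname{tr}(u_iu'_j)\big)_{i,j=1}^v$, where $\{u_i\}_{i=1}^v$ and $\{u'_i\}_{i=1}^v$ range over all $v$-element subsets of $A$. Write $(-)^\vee=\operatorname{Hom}_Z(-,Z)$. An element $d\in A$ is normal if $dA=Ad$. Then these notions are well defined for $A/Z$: the ring $A$ is prime and a finitely generated $Z$-module,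 $\operatorname{tr}(A)\subseteq Z$, and $A$ is a reflexive $Z$-module. Moreover, for all positive integers $p$ and $v$, the $p$-power extended reflexive hull $v$-discriminant of $A$ over $Z$ exists: for $M=MD_v(A/Z)^p A$, the map $M^{\vee\vee}\to A^{\vee\vee}\cong A$ induced by the inclusion $M\subseteq A$ is injective, and its image $M^{\vee\vee}\subseteq A$ is a principal ideal $dA=Ad$ of $A$ generated by a normal element $d\in A$. In particular (the case $p=1$, $v=w$), the $\overline{\mathcal R}$-discriminant of $A$ over $Z$ exists: $(MD_w(A/Z)A)^{\vee\vee}$ is a principal ideal of $A$ generated by a normal element. -/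

import Mathlib

open scoped TensorProduct

namespace SkewDisc

universe u v

/-- The defining relations `x_j x_i = q_ij x_i x_j`, for `i < j`, of a skew polynomial ring. -/
inductive SkewRel {k : Type u} [Field k] {n : ℕ} (q : Fin n → Fin n → kˣ) :
    FreeAlgebra k (Fin n) → FreeAlgebra k (Fin n) → Prop
  | rel (i j : Fin n) (hij : i < j) :
      SkewRel q (FreeAlgebra.ι k j * FreeAlgebra.ι k i)
        ((q i j : k) • (FreeAlgebra.ι k i * FreeAlgebra.ι k j))

/-- The skew polynomial ring `k_q[x_1, …, x_n]`: the `k`-algebra generated by `x_1, …, x_n`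
subject to the relations `x_j x_i = q_ij x_i x_j` for `i < j`. -/
def SkewPolynomialRing {k : Type u} [Field k] {n : ℕ} (q : Fin n → Fin n → kˣ) : Type u :=
  RingQuot (SkewRel q)

noncomputable instance {k : Type u} [Field k] {n : ℕ} (q : Fin n → Fin n → kˣ) :
    Ring (SkewPolynomialRing q) :=
  inferInstanceAs (Ring (RingQuot (SkewRel q)))

noncomputable instance {k : Type u} [Field k] {n : ℕ} (q : Fin n → Fin n → kˣ) :
    Algebra k (SkewPolynomialRing q) :=
  inferInstanceAs (Algebra k (RingQuot (SkewRel q)))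

section Discriminants

variable (R : Type u) (B : Type v) [CommRing R] [Ring B] [Algebra R B]

/-- The regular trace `B → F`, with `F` the fraction field of the domain `R`: the trace of left
multiplication by `b` on the finite-dimensional `F`-vector space `B_F = F ⊗ B`. (Any other
localization `F'` of `R` over which `B` becomes free of finite rank gives the same trace.) -/
noncomputable def regularTrace (b : B) : FractionRing R :=
  LinearMap.trace (FractionRing R) (FractionRing R ⊗[R] B)
    (LinearMap.mulLeft (FractionRing R) ((1 : FractionRing R) ⊗ₜ[R] b))

/-- The rank of `B` over the domain `R`: the dimension of `F ⊗ B` over the fraction field `F`. -/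
noncomputable def genericRank : ℕ :=
  Module.finrank (FractionRing R) (FractionRing R ⊗[R] B)

/-- A (not necessarily commutative) ring is prime if it is nonzero and `a B b = 0` implies `a = 0`
or `b = 0`. -/
def IsPrimeRing (B : Type v) [Ring B] : Prop :=
  Nontrivial B ∧ ∀ a b : B, (∀ r : B, a * r * b = 0) → a = 0 ∨ b = 0

/-- The standing hypothesis under which discriminants are defined: `B` is a prime ring containing
`R` as a central subring, `B` is a finitely generated `R`-module, and the regular trace takes
values in `R`. -/
structure DiscriminantHypothesis : Prop where
  algebraMap_injective : Function.Injective (algebraMap R B)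
  prime : IsPrimeRing B
  finite : Module.Finite R B
  trace_mem : ∀ b : B, regularTrace R B b ∈ Set.range (algebraMap R (FractionRing R))

/-- The modified `m`-discriminant ideal `MD_m(B/R)`: the ideal of `R` generated by the elements
`det (tr (u_i u'_j))`, where `{u_i}` and `{u'_j}` range over all `m`-element subsets of `B`. The
subsets are enumerated by injective families; another enumeration only changes the sign of the
determinant. -/
noncomputable def modifiedDiscriminantIdeal (m : ℕ) : Ideal R :=
  Ideal.span {r : R | ∃ u u' : Fin m → B, Function.Injective u ∧ Function.Injective u' ∧
    algebraMap R (FractionRing R) r =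
      (Matrix.of fun i j => regularTrace R B (u i * u' j)).det}

/-- The extension `I B` to `B` of an ideal `I` of the central subring `R`. It is the two-sided
ideal of `B` generated by `I`; it is regarded here as an `R`-submodule of `B`. -/
def extendedIdeal (I : Ideal R) : Submodule R B :=
  I • (⊤ : Submodule R B)

variable {R B}

/-- The canonical map `M^∨∨ → B^∨∨` between `R`-biduals induced by the inclusion of `M` in `B`. -/
def bidualInclusion (M : Submodule R B) :
    Module.Dual R (Module.Dual R M) →ₗ[R] Module.Dual R (Module.Dual R B) :=
  M.subtype.dualMap.dualMap

/-- The reflexive hull `M^∨∨` of a submodule `M` of a reflexive module `B`, regarded as a submodule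
of `B` through `M^∨∨ → B^∨∨ ≅ B`: it consists of those `b` in `B` for which evaluation at `b`
lies in the image of `M^∨∨`. -/
def reflexiveHull (M : Submodule R B) : Submodule R B :=
  (LinearMap.range (bidualInclusion M)).comap (Module.Dual.eval R B)

/-- `d` is a normal element of `B`: `d B = B d`. -/
def IsNormalElement (d : B) : Prop :=
  Set.range (fun b : B => d * b) = Set.range (fun b : B => b * d)

variable (R B)

/-- The reflexive hull `M^∨∨` is a principal ideal of `B` generated by the normal element `d`. The
first field says that `M^∨∨ → B^∨∨` is an embedding, so that `M^∨∨` really is identified with the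
submodule `reflexiveHull M` of the reflexive module `B`. -/
structure HullGeneratedBy (M : Submodule R B) (d : B) : Prop where
  embeds : Function.Injective (bidualInclusion M)
  normal : IsNormalElement d
  hull_eq : reflexiveHull M = LinearMap.range (LinearMap.mulLeft R d)

/-- `d` is a `p`-power extended reflexive hull `m`-discriminant of `B` over `R`:
`(MD_m(B/R)^p B)^∨∨` is a principal ideal of `B` generated by the normal element `d`. -/
def IsPowerExtendedReflexiveHullDiscriminant (p m : ℕ) (d : B) : Prop :=
  HullGeneratedBy R B (extendedIdeal R B (modifiedDiscriminantIdeal R B m ^ p)) d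

/-- `d` is an extended reflexive hull discriminant of `B` over `R`: `(MD_w(B/R) B)^∨∨`, where `w`
is the rank of `B` over `R`, is a principal ideal of `B` generated by the normal element `d`. -/
def IsExtendedReflexiveHullDiscriminant (d : B) : Prop :=
  HullGeneratedBy R B (extendedIdeal R B (modifiedDiscriminantIdeal R B (genericRank R B))) d

end Discriminants

end SkewDisc

namespace SkewDisc

section Bidual

variable {R B : Type*} [CommRing R] [IsDomain R]

/-- A linear functional whose values are all divisible by `z ≠ 0` can be divided by `z`. -/
theorem exists_dual_div [AddCommGroup B] [Module R B] {z : R} (hz : z ≠ 0)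
    (f : Module.Dual R B) (h : ∀ b, z ∣ f b) : ∃ g : Module.Dual R B, ∀ b, f b = z * g b := by
  choose g hg using h
  refine ⟨⟨⟨g, fun a b => ?_⟩, fun r a => ?_⟩, hg⟩
  · apply mul_left_cancel₀ hz
    rw [← hg, map_add, hg a, hg b, mul_add]
  · apply mul_left_cancel₀ hz
    rw [← hg, map_smul, hg a]
    simp only [smul_eq_mul, RingHom.id_apply]
    ring

/-- A criterion for reflexivity over a domain: biduals are evaluations up to the denominator `x`,
and divisibility by `x` is detected by functionals. -/
theorem isReflexive_of_denominator [AddCommGroup B] [Module R B] {x : R} (hx : x ≠ 0)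
    (hinj : ∀ y : B, (∀ g : Module.Dual R B, g y = 0) → y = 0)
    (hsurj : ∀ Φ : Module.Dual R (Module.Dual R B), ∃ y : B, ∀ g, x * Φ g = g y)
    (hdvd : ∀ y : B, (∀ g : Module.Dual R B, x ∣ g y) → ∃ y', y = x • y') :
    Module.IsReflexive R B := by
  refine ⟨(injective_iff_map_eq_zero _).2 fun y hy => hinj y fun g => ?_, fun Φ => ?_⟩
  · exact LinearMap.congr_fun hy g
  · obtain ⟨y, hy⟩ := hsurj Φ
    obtain ⟨y', rfl⟩ := hdvd y fun g => ⟨Φ g, (hy g).symm⟩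
    refine ⟨y', LinearMap.ext fun g => mul_left_cancel₀ hx ?_⟩
    rw [hy, map_smul]
    rfl

variable [Ring B] [Algebra R B]

theorem bidualInclusion_injective (M : Submodule R B) {z : R} (hz : z ≠ 0)
    (hM : ∀ b : B, z • b ∈ M) : Function.Injective (bidualInclusion M) := by
  refine (injective_iff_map_eq_zero _).2 fun Φ hΦ => LinearMap.ext fun f => ?_
  let g : Module.Dual R B := f ∘ₗ (LinearMap.lsmul R B z).codRestrict M hM
  have h1 : g ∘ₗ M.subtype = z • f := by
    ext m
    have : (LinearMap.lsmul R B z).codRestrict M hM m = z • m := rfl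
    simp [g, this]
  have h2 : Φ (g ∘ₗ M.subtype) = 0 := LinearMap.congr_fun hΦ g
  rw [h1, map_smul, smul_eq_mul] at h2
  exact (mul_eq_zero.1 h2).resolve_left hz

theorem mem_reflexiveHull_iff (M : Submodule R B) {z : R} (hz : z ≠ 0)
    (hM : ∀ b : B, z • b ∈ M) (b : B) :
    b ∈ reflexiveHull M ↔ ∀ f : Module.Dual R M, z ∣ f ⟨z • b, hM b⟩ := by
  constructor
  · rintro ⟨Φ, hΦ⟩ f
    let g : Module.Dual R B := f ∘ₗ (LinearMap.lsmul R B z).codRestrict M hM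
    have h1 : g ∘ₗ M.subtype = z • f := by
      ext m
      have : (LinearMap.lsmul R B z).codRestrict M hM m = z • m := rfl
      simp [g, this]
    have h2 : Φ (g ∘ₗ M.subtype) = g b := LinearMap.congr_fun hΦ g
    rw [h1, map_smul, smul_eq_mul] at h2
    exact ⟨_, h2.symm⟩
  · intro h
    obtain ⟨Φ, hΦ⟩ := exists_dual_div hz (Module.Dual.eval R M ⟨z • b, hM b⟩) h
    refine ⟨Φ, LinearMap.ext fun g => mul_left_cancel₀ hz ?_⟩
    change z * Φ (g ∘ₗ M.subtype) = z * g b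
    rw [← hΦ]
    change g (z • b) = _
    rw [map_smul, smul_eq_mul]

omit [IsDomain R] in
/-- The zero ideal has zero reflexive hull in a reflexive module. -/
theorem hullGeneratedBy_bot (h : Module.IsReflexive R B) :
    HullGeneratedBy R B (⊥ : Submodule R B) 0 where
  embeds := by
    refine (injective_iff_map_eq_zero _).2 fun Φ _ => LinearMap.ext fun f => ?_
    rw [Subsingleton.elim f 0, map_zero, map_zero]
  normal := by simp [IsNormalElement]
  hull_eq := by
    refine le_antisymm ?_ ?_
    · rintro b ⟨Φ, hΦ⟩
      have h0 : Module.Dual.eval R B b = 0 := by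
        rw [← hΦ]
        refine LinearMap.ext fun g => ?_
        change Φ (g ∘ₗ (⊥ : Submodule R B).subtype) = 0
        rw [Subsingleton.elim (g ∘ₗ (⊥ : Submodule R B).subtype) 0, map_zero]
      have : b = 0 := h.bijective_dual_eval'.1 (by rw [h0, map_zero])
      rw [this]
      exact zero_mem _
    · rintro _ ⟨b, rfl⟩
      simp

end Bidual

/-- A `k`-basis of `A` indexed by the exponents `ℕⁿ`, multiplicative up to units of `k`. -/
structure MonomialBasis (k A : Type*) [Field k] [Ring A] [Algebra k A] (n : ℕ) where
  /-- The basis of monomials. -/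
  mono : Module.Basis (Fin n → ℕ) k A
  /-- The scalars in the products of monomials. -/
  twist : (Fin n → ℕ) → (Fin n → ℕ) → kˣ
  mono_mul : ∀ a b, mono a * mono b = (twist a b : k) • mono (a + b)
  mono_zero : mono 0 = 1

namespace MonomialBasis

variable {k A : Type*} [Field k] [Ring A] [Algebra k A] {n : ℕ} (X : MonomialBasis k A n)

/-- The coefficient of `y` at the monomial with exponent `c`. -/
noncomputable def coeff (y : A) (c : Fin n → ℕ) : k := X.mono.repr y c

theorem coeff_add (y y' : A) (c : Fin n → ℕ) : X.coeff (y + y') c = X.coeff y c + X.coeff y' c := by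
  simp [coeff]

theorem coeff_smul (r : k) (y : A) (c : Fin n → ℕ) : X.coeff (r • y) c = r * X.coeff y c := by
  simp [coeff]

theorem coeff_zero (c : Fin n → ℕ) : X.coeff 0 c = 0 := by simp [coeff]

theorem coeff_mono (a c : Fin n → ℕ) : X.coeff (X.mono a) c = if a = c then 1 else 0 := by
  simp [coeff, Finsupp.single_apply]

theorem coeff_sum {ι : Type*} (s : Finset ι) (f : ι → A) (c : Fin n → ℕ) :
    X.coeff (∑ i ∈ s, f i) c = ∑ i ∈ s, X.coeff (f i) c := by
  simp [coeff, Finsupp.finsetSum_apply]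

theorem ext_coeff {y y' : A} (h : ∀ c, X.coeff y c = X.coeff y' c) : y = y' :=
  X.mono.repr.injective (Finsupp.ext h)

theorem exists_coeff_ne_zero {y : A} (h : y ≠ 0) : ∃ c, X.coeff y c ≠ 0 := by
  by_contra! H
  exact h (X.ext_coeff fun c => by rw [H c, coeff_zero])

theorem sum_coeff (y : A) : ∑ a ∈ (X.mono.repr y).support, X.coeff y a • X.mono a = y :=
  X.mono.linearCombination_repr y

theorem mono_add (a b : Fin n → ℕ) :
    X.mono (a + b) = ((X.twist a b)⁻¹ : kˣ) • (X.mono a * X.mono b) := by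
  rw [X.mono_mul, Units.smul_def, smul_smul, ← Units.val_mul, inv_mul_cancel, Units.val_one,
    one_smul]

/-- Membership in a `k`-subspace follows from that of the monomials that occur. -/
theorem mem_of_mono_mem (V : Submodule k A) {y : A}
    (h : ∀ c, X.coeff y c ≠ 0 → X.mono c ∈ V) : y ∈ V := by
  rw [← X.sum_coeff y]
  exact V.sum_mem fun c hc => V.smul_mem _ (h c (Finsupp.mem_support_iff.1 hc))

open Classical in
theorem coeff_mono_mul (a : Fin n → ℕ) (y : A) (d : Fin n → ℕ) :
    X.coeff (X.mono a * y) d = if a ≤ d then (X.twist a (d - a) : k) * X.coeff y (d - a) else 0 := by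
  let f : A →ₗ[k] k := (Finsupp.lapply d ∘ₗ X.mono.repr.toLinearMap) ∘ₗ LinearMap.mulLeft k (X.mono a)
  let g : A →ₗ[k] k := (if a ≤ d then (X.twist a (d - a) : k) else 0) •
    (Finsupp.lapply (d - a) ∘ₗ X.mono.repr.toLinearMap)
  have hfg : f = g := by
    refine X.mono.ext fun b => ?_
    change X.coeff (X.mono a * X.mono b) d = _ * X.coeff (X.mono b) (d - a)
    rw [X.mono_mul, coeff_smul, coeff_mono, coeff_mono]
    by_cases had : a ≤ d
    · by_cases h : a + b = d
      · subst h
        simp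
      · have : b ≠ d - a := by
          rintro rfl
          exact h (add_tsub_cancel_of_le had)
        simp [h, this]
    · have : a + b ≠ d := by
        rintro rfl
        exact had le_self_add
      simp [had, this]
  have := LinearMap.congr_fun hfg y
  change X.coeff (X.mono a * y) d = _ * X.coeff y (d - a) at this
  rw [this]
  split_ifs <;> simp

open Classical in
theorem coeff_mul_mono (a : Fin n → ℕ) (y : A) (d : Fin n → ℕ) :
    X.coeff (y * X.mono a) d = if a ≤ d then (X.twist (d - a) a : k) * X.coeff y (d - a) else 0 := by
  let f : A →ₗ[k] k :=
    (Finsupp.lapply d ∘ₗ X.mono.repr.toLinearMap) ∘ₗ LinearMap.mulRight k (X.mono a)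
  let g : A →ₗ[k] k := (if a ≤ d then (X.twist (d - a) a : k) else 0) •
    (Finsupp.lapply (d - a) ∘ₗ X.mono.repr.toLinearMap)
  have hfg : f = g := by
    refine X.mono.ext fun b => ?_
    change X.coeff (X.mono b * X.mono a) d = _ * X.coeff (X.mono b) (d - a)
    rw [X.mono_mul, coeff_smul, coeff_mono, coeff_mono]
    by_cases had : a ≤ d
    · by_cases h : b + a = d
      · subst h
        simp
      · have : b ≠ d - a := by
          rintro rfl
          exact h (tsub_add_cancel_of_le had)
        simp [h, this]
    · have : b + a ≠ d := by
        rintro rfl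
        exact had le_add_self
      simp [had, this]
  have := LinearMap.congr_fun hfg y
  change X.coeff (y * X.mono a) d = _ * X.coeff y (d - a) at this
  rw [this]
  split_ifs <;> simp

theorem coeff_mul (y y' : A) (c : Fin n → ℕ) :
    X.coeff (y * y') c =
      ∑ a ∈ (X.mono.repr y).support, X.coeff y a * X.coeff (X.mono a * y') c := by
  conv_lhs => rw [← X.sum_coeff y]
  rw [Finset.sum_mul, coeff_sum]
  exact Finset.sum_congr rfl fun a _ => by rw [smul_mul_assoc, coeff_smul]

theorem exists_of_coeff_mul_ne_zero {y y' : A} {c : Fin n → ℕ} (h : X.coeff (y * y') c ≠ 0) :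
    ∃ a b, X.coeff y a ≠ 0 ∧ X.coeff y' b ≠ 0 ∧ a + b = c := by
  rw [coeff_mul] at h
  obtain ⟨a, ha, hac⟩ := Finset.exists_ne_zero_of_sum_ne_zero h
  rw [coeff_mono_mul] at hac
  have hle : a ≤ c := by
    by_contra hle
    simp [hle] at hac
  rw [if_pos hle] at hac
  exact ⟨a, c - a, left_ne_zero_of_mul hac, right_ne_zero_of_mul (right_ne_zero_of_mul hac),
    add_tsub_cancel_of_le hle⟩

include X in
theorem isDomain : IsDomain A := by
  have : Nontrivial A := ⟨⟨X.mono 0, 0, X.mono.ne_zero 0⟩⟩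
  have : NoZeroDivisors A := by
    refine ⟨fun {y y'} h => ?_⟩
    by_contra! H
    have hs : ∀ {z : A}, z ≠ 0 → (X.mono.repr z).support.Nonempty := fun {z} hz => by
      obtain ⟨c, hc⟩ := X.exists_coeff_ne_zero hz
      exact ⟨c, Finsupp.mem_support_iff.2 hc⟩
    obtain ⟨a, ha, b, hb, hab⟩ := UniqueSums.uniqueAdd_of_nonempty (hs H.1) (hs H.2)
    have h0 : X.coeff (y * y') (a + b) = 0 := by rw [h, coeff_zero]
    rw [coeff_mul, Finset.sum_eq_single a] at h0
    · rw [coeff_mono_mul, if_pos le_self_add, add_tsub_cancel_left] at h0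
      exact mul_ne_zero (Finsupp.mem_support_iff.1 ha)
        (mul_ne_zero (Units.ne_zero _) (Finsupp.mem_support_iff.1 hb)) h0
    · intro a' ha' hne
      rw [coeff_mono_mul]
      split_ifs with hle
      · by_cases hz : X.coeff y' (a + b - a') = 0
        · rw [hz, mul_zero, mul_zero]
        · exact absurd (hab ha' (Finsupp.mem_support_iff.2 hz) (add_tsub_cancel_of_le hle)).1 hne
      · rw [mul_zero]
    · intro h
      exact absurd ha h
  exact NoZeroDivisors.to_isDomain A

/-- Divisibility by a monomial is a condition on the exponents that occur. -/
theorem exists_eq_mono_mul_iff (a : Fin n → ℕ) (y : A) :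
    (∃ y', y = X.mono a * y') ↔ ∀ c, X.coeff y c ≠ 0 → a ≤ c := by
  constructor
  · rintro ⟨y', rfl⟩ c hc
    rw [coeff_mono_mul] at hc
    by_contra hle
    simp [hle] at hc
  · intro h
    have : y ∈ LinearMap.range (LinearMap.mulLeft k (X.mono a)) := by
      refine X.mem_of_mono_mem _ fun c hc => ⟨((X.twist a (c - a))⁻¹ : kˣ) • X.mono (c - a), ?_⟩
      rw [LinearMap.mulLeft_apply, mul_smul_comm, ← X.mono_add, add_tsub_cancel_of_le (h c hc)]
    obtain ⟨y', hy'⟩ := this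
    exact ⟨y', hy'.symm⟩

theorem exists_eq_mul_mono_iff (a : Fin n → ℕ) (y : A) :
    (∃ y', y = y' * X.mono a) ↔ ∀ c, X.coeff y c ≠ 0 → a ≤ c := by
  constructor
  · rintro ⟨y', rfl⟩ c hc
    rw [coeff_mul_mono] at hc
    by_contra hle
    simp [hle] at hc
  · intro h
    have : y ∈ LinearMap.range (LinearMap.mulRight k (X.mono a)) := by
      refine X.mem_of_mono_mem _ fun c hc => ⟨((X.twist (c - a) a)⁻¹ : kˣ) • X.mono (c - a), ?_⟩
      rw [LinearMap.mulRight_apply, smul_mul_assoc, ← X.mono_add, tsub_add_cancel_of_le (h c hc)]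
    obtain ⟨y', hy'⟩ := this
    exact ⟨y', hy'.symm⟩

theorem isNormalElement_mono (a : Fin n → ℕ) : IsNormalElement (X.mono a) := by
  ext y
  have h1 := X.exists_eq_mono_mul_iff a y
  have h2 := X.exists_eq_mul_mono_iff a y
  simp only [Set.mem_range, eq_comm (b := y)]
  exact h1.trans h2.symm

/-- The scalar `β` with `x^a x^c = β x^c x^a`. -/
def commChar (a c : Fin n → ℕ) : kˣ := X.twist a c / X.twist c a

theorem mono_comm (a c : Fin n → ℕ) :
    X.mono a * X.mono c = (X.commChar a c : k) • (X.mono c * X.mono a) := by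
  rw [X.mono_mul, X.mono_mul, smul_smul, ← Units.val_mul, commChar, div_mul_cancel, add_comm]

theorem commChar_eq_of_mono_comm {a c : Fin n → ℕ} {r : k}
    (h : X.mono a * X.mono c = r • (X.mono c * X.mono a)) : (X.commChar a c : k) = r := by
  have := X.isDomain
  rw [X.mono_comm] at h
  exact smul_left_injective k (mul_ne_zero (X.mono.ne_zero c) (X.mono.ne_zero a)) h

theorem commChar_add (a b : Fin n → ℕ) : X.commChar (a + b) = X.commChar a * X.commChar b := by
  funext c
  refine Units.ext (X.commChar_eq_of_mono_comm ?_)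
  rw [X.mono_add, smul_mul_assoc, mul_smul_comm, smul_comm]
  congr 1
  rw [mul_assoc, X.mono_comm b c, mul_smul_comm, ← mul_assoc, X.mono_comm a c, smul_mul_assoc,
    smul_smul, mul_assoc, mul_comm, Pi.mul_apply, Units.val_mul, mul_comm]

theorem commChar_zero : X.commChar 0 = 1 := by
  have := X.commChar_add 0 0
  rw [add_zero] at this
  exact left_eq_mul.1 this

theorem commChar_nsmul (m : ℕ) (a : Fin n → ℕ) : X.commChar (m • a) = X.commChar a ^ m := by
  induction m with
  | zero => rw [zero_smul, pow_zero, commChar_zero]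
  | succ m ih => rw [succ_nsmul, commChar_add, ih, pow_succ]

theorem mono_mem_center_iff (a : Fin n → ℕ) :
    X.mono a ∈ Subring.center A ↔ X.commChar a = 1 := by
  constructor
  · intro h
    funext c
    refine Units.ext (X.commChar_eq_of_mono_comm ?_)
    rw [Pi.one_apply, Units.val_one, one_smul, Subring.mem_center_iff.1 h]
  · intro h
    refine Subring.mem_center_iff.2 fun y => ?_
    have : LinearMap.mulRight k (X.mono a) = LinearMap.mulLeft k (X.mono a) := by
      refine X.mono.ext fun c => ?_
      rw [LinearMap.mulRight_apply, LinearMap.mulLeft_apply, X.mono_comm a c, h]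
      simp
    exact LinearMap.congr_fun this y

theorem commChar_eq_one_of_mem_center {z : A} (hz : z ∈ Subring.center A) {c : Fin n → ℕ}
    (hc : X.coeff z c ≠ 0) : X.commChar c = 1 := by
  funext a
  have h : X.coeff (X.mono a * z) (a + c) = X.coeff (z * X.mono a) (a + c) := by
    rw [Subring.mem_center_iff.1 hz]
  rw [coeff_mono_mul, coeff_mul_mono, if_pos le_self_add, if_pos le_self_add,
    add_tsub_cancel_left] at h
  rw [commChar, Units.ext (mul_right_cancel₀ hc h), div_self', Pi.one_apply]

theorem mem_center_of_commChar {z : A} (hz : ∀ c, X.coeff z c ≠ 0 → X.commChar c = 1) :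
    z ∈ Subring.center A := by
  have h : z ∈ Subalgebra.toSubmodule (Subalgebra.center k A) :=
    X.mem_of_mono_mem _ fun c hc => (X.mono_mem_center_iff c).2 (hz c hc)
  exact h

/-- The monomials of the center. -/
noncomputable def centralMono (t : Fin n → ℕ) (ht : X.commChar t = 1) : Subring.center A :=
  ⟨X.mono t, (X.mono_mem_center_iff t).2 ht⟩

theorem centralMono_ne_zero (t : Fin n → ℕ) (ht : X.commChar t = 1) : X.centralMono t ht ≠ 0 :=
  fun h => X.mono.ne_zero t (congrArg Subtype.val h)

include X in
theorem mem_center_of_mul_mem {x y : A} (hx : x ∈ Subring.center A) (hx0 : x ≠ 0)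
    (h : x * y ∈ Subring.center A) : y ∈ Subring.center A := by
  have := X.isDomain
  refine Subring.mem_center_iff.2 fun g => mul_left_cancel₀ hx0 ?_
  rw [← mul_assoc, ← Subring.mem_center_iff.1 hx g, mul_assoc, Subring.mem_center_iff.1 h g,
    mul_assoc]

theorem centralMono_dvd_iff (t : Fin n → ℕ) (ht : X.commChar t = 1) (z : Subring.center A) :
    X.centralMono t ht ∣ z ↔ ∀ c, X.coeff (z : A) c ≠ 0 → t ≤ c := by
  rw [← X.exists_eq_mono_mul_iff]
  constructor
  · rintro ⟨w, rfl⟩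
    exact ⟨w, rfl⟩
  · rintro ⟨y, hy⟩
    exact ⟨⟨y, X.mem_center_of_mul_mem ((X.mono_mem_center_iff t).2 ht) (X.mono.ne_zero t)
      (hy ▸ z.2)⟩, Subtype.ext hy⟩

open Classical in
/-- The projection of `A` to its center that discards the monomials that are not central. -/
noncomputable def projAux (y : A) : A :=
  X.mono.repr.symm ((X.mono.repr y).filter fun c => X.commChar c = 1)

open Classical in
theorem coeff_projAux (y : A) (c : Fin n → ℕ) :
    X.coeff (X.projAux y) c = if X.commChar c = 1 then X.coeff y c else 0 := by
  simp [coeff, projAux, Finsupp.filter_apply]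

theorem projAux_mem_center (y : A) : X.projAux y ∈ Subring.center A := by
  refine X.mem_center_of_commChar fun c hc => ?_
  by_contra h
  rw [coeff_projAux, if_neg h] at hc
  exact hc rfl

theorem projAux_add (y y' : A) : X.projAux (y + y') = X.projAux y + X.projAux y' :=
  X.ext_coeff fun c => by
    simp only [coeff_projAux, coeff_add]
    split_ifs <;> simp

theorem projAux_of_mem_center {z : A} (hz : z ∈ Subring.center A) : X.projAux z = z := by
  refine X.ext_coeff fun c => ?_
  rw [coeff_projAux]
  split_ifs with h
  · rfl
  · by_contra h'
    exact h (X.commChar_eq_one_of_mem_center hz (Ne.symm h'))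

theorem projAux_mul {z : A} (hz : z ∈ Subring.center A) (y : A) :
    X.projAux (z * y) = z * X.projAux y := by
  have h1 : z * y = z * X.projAux y + z * (y - X.projAux y) := by rw [← mul_add]; congr 1; abel
  have h2 : X.projAux (z * (y - X.projAux y)) = 0 := by
    refine X.ext_coeff fun c => ?_
    rw [coeff_projAux, coeff_zero]
    split_ifs with h
    · by_contra hc
      obtain ⟨a, b, ha, hb, rfl⟩ := X.exists_of_coeff_mul_ne_zero hc
      rw [commChar_add, X.commChar_eq_one_of_mem_center hz ha, one_mul] at h
      have h3 : X.coeff (y - X.projAux y + X.projAux y) b = X.coeff y b := by rw [sub_add_cancel]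
      rw [coeff_add, coeff_projAux, if_pos h, add_eq_right] at h3
      exact hb h3
    · rfl
  rw [h1, projAux_add, h2, add_zero,
    X.projAux_of_mem_center (Subring.mul_mem _ hz (X.projAux_mem_center y))]

/-- The projection of `A` to its center, as a linear map over the center. -/
noncomputable def proj : Module.Dual (Subring.center A) A where
  toFun y := ⟨X.projAux y, X.projAux_mem_center y⟩
  map_add' y y' := Subtype.ext (X.projAux_add y y')
  map_smul' z y := Subtype.ext (X.projAux_mul z.2 y)

open Classical in
theorem coeff_proj (y : A) (c : Fin n → ℕ) :
    X.coeff (X.proj y : A) c = if X.commChar c = 1 then X.coeff y c else 0 :=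
  X.coeff_projAux y c

theorem coe_proj_mono_of_eq_one {c : Fin n → ℕ} (h : X.commChar c = 1) :
    (X.proj (X.mono c) : A) = X.mono c :=
  X.projAux_of_mem_center ((X.mono_mem_center_iff c).2 h)

theorem proj_mono_of_ne_one {c : Fin n → ℕ} (h : X.commChar c ≠ 1) : X.proj (X.mono c) = 0 := by
  refine Subtype.ext (X.ext_coeff fun d => ?_)
  rw [coeff_proj, coeff_mono]
  split_ifs with h1 h2
  · exact absurd (h2 ▸ h1) h
  · exact (X.coeff_zero d).symm
  · exact (X.coeff_zero d).symm

/-- The functional `y ↦ π(x^s y)`. -/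
noncomputable def functional (s : Fin n → ℕ) : Module.Dual (Subring.center A) A :=
  X.proj ∘ₗ LinearMap.mulLeft (Subring.center A) (X.mono s)

theorem functional_apply (s : Fin n → ℕ) (y : A) : X.functional s y = X.proj (X.mono s * y) := rfl

theorem coeff_functional_ne_zero_iff (s : Fin n → ℕ) (y : A) (d : Fin n → ℕ) :
    X.coeff (X.functional s y : A) d ≠ 0 ↔
      X.commChar d = 1 ∧ s ≤ d ∧ X.coeff y (d - s) ≠ 0 := by
  rw [functional_apply, coeff_proj, coeff_mono_mul]
  by_cases h1 : X.commChar d = 1 <;> by_cases h2 : s ≤ d <;> simp [h1, h2]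

end MonomialBasis

noncomputable instance centerAlgebra {k A : Type*} [Field k] [Ring A] [Algebra k A] :
    Algebra k (Subring.center A) :=
  RingHom.toAlgebra ((algebraMap k A).codRestrict (Subring.center A) fun r =>
    Subring.mem_center_iff.2 fun g => (Algebra.commutes r g).symm)

instance {k A : Type*} [Field k] [Ring A] [Algebra k A] :
    IsScalarTower k (Subring.center A) A :=
  IsScalarTower.of_algebraMap_eq fun _ => rfl

namespace MonomialBasis

variable {k A : Type*} [Field k] [Ring A] [Algebra k A] {n : ℕ} (X : MonomialBasis k A n)

include X in
theorem isDomain_center : IsDomain (Subring.center A) :=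
  have := X.isDomain
  inferInstance

theorem coeff_coe_add (z z' : Subring.center A) (c : Fin n → ℕ) :
    X.coeff ((z + z' : Subring.center A) : A) c = X.coeff (z : A) c + X.coeff (z' : A) c :=
  X.coeff_add _ _ c

theorem center_linearMap_ext {P : Type*} [AddCommGroup P] [Module (Subring.center A) P]
    {f g : A →ₗ[Subring.center A] P} (h : ∀ a, f (X.mono a) = g (X.mono a)) : f = g := by
  refine LinearMap.ext fun y => ?_
  rw [← X.sum_coeff y, map_sum, map_sum]
  refine Finset.sum_congr rfl fun a _ => ?_
  rw [← algebraMap_smul (Subring.center A) (X.coeff y a), map_smul, map_smul, h]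

theorem commChar_single_mul {N : ℕ} (hN : ∀ a, X.commChar a ^ N = 1) (j : Fin n) (p : ℕ) :
    X.commChar (Pi.single j (N * p)) = 1 := by
  have : (Pi.single j (N * p) : Fin n → ℕ) = N • Pi.single j p := by
    rw [← Pi.single_smul, smul_eq_mul]
  rw [this, commChar_nsmul, hN]

theorem commChar_congr {N : ℕ} (hN : ∀ a, X.commChar a ^ N = 1) {s s' : Fin n → ℕ} {j : Fin n}
    {p p' : ℕ} (h : ∀ i, i ≠ j → s i = s' i) (hj : s j + N * p = s' j + N * p') :
    X.commChar s = X.commChar s' := by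
  have : s + Pi.single j (N * p) = s' + Pi.single j (N * p') := by
    funext i
    by_cases hi : i = j
    · subst hi
      simpa using hj
    · simp [hi, h i hi]
  have := congrArg X.commChar this
  rwa [commChar_add, commChar_add, commChar_single_mul X hN, commChar_single_mul X hN, mul_one,
    mul_one] at this

/-- For an exponent `c` and an index `j` there is a functional `y ↦ π(x^s y)` all of whose values
are divisible by `x_j^N`, such that `x^s x^c` is central and has `x_j`-degree at most `N + c_j`. -/
theorem exists_sharp_exponent {N : ℕ} (hN0 : 0 < N) (hN : ∀ a, X.commChar a ^ N = 1)
    (c : Fin n → ℕ) (j : Fin n) :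
    ∃ s : Fin n → ℕ, X.commChar (s + c) = 1 ∧ s j ≤ N ∧
      ∀ a, X.commChar (s + a) = 1 → N ≤ s j + a j := by
  classical
  let P : ℕ → Prop := fun m => ∃ s : Fin n → ℕ, X.commChar (s + c) = 1 ∧ s j = m
  have hP : P ((((N - 1) • c) j) % N) := by
    refine ⟨Function.update ((N - 1) • c) j ((((N - 1) • c) j) % N), ?_, by simp⟩
    rw [commChar_add, X.commChar_congr hN (j := j) (s' := (N - 1) • c)
      (p := (((N - 1) • c) j) / N) (p' := 0), ← commChar_add, ← succ_nsmul, Nat.sub_add_cancel hN0,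
      commChar_nsmul, hN]
    · intro i hi
      simp [hi]
    · rw [Function.update_self, Nat.mod_add_div, mul_zero, add_zero]
  obtain ⟨s, hs, hsm⟩ := Nat.findGreatest_spec (P := P) (Nat.mod_lt _ hN0).le hP
  refine ⟨s, hs, hsm ▸ Nat.findGreatest_le N, fun a ha => ?_⟩
  by_contra! hlt
  refine Nat.findGreatest_is_greatest (P := P) (n := N) (k := s j + N - (s j + a j))
    (by omega) (by omega) ⟨Function.update (s + (N - 1) • (s + a)) j (s j + N - (s j + a j)),
      ?_, by simp⟩
  rw [commChar_add, X.commChar_congr hN (j := j) (s' := s + (N - 1) • (s + a))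
    (p := s j + a j) (p' := 1), commChar_add X s, commChar_nsmul, ha, one_pow, mul_one,
    ← commChar_add, hs]
  · intro i hi
    simp [hi]
  · obtain ⟨M, rfl⟩ : ∃ M, N = M + 1 := ⟨N - 1, by omega⟩
    simp only [Function.update_self, Pi.add_apply, Pi.smul_apply, smul_eq_mul, Nat.add_sub_cancel]
    rw [add_mul, one_mul]
    omega

/-- Functionals detect divisibility by central monomials. -/
theorem le_of_forall_dvd {N : ℕ} (hN0 : 0 < N) (hN : ∀ a, X.commChar a ^ N = 1)
    {t : Fin n → ℕ} (ht : X.commChar t = 1) {y : A}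
    (h : ∀ g : Module.Dual (Subring.center A) A, X.centralMono t ht ∣ g y)
    {c : Fin n → ℕ} (hc : X.coeff y c ≠ 0) : t ≤ c := by
  intro j
  have := X.isDomain_center
  obtain ⟨s, hs, hsj, hsa⟩ := X.exists_sharp_exponent hN0 hN c j
  have hu : X.commChar (Pi.single j N) = 1 := by
    have := X.commChar_single_mul hN j 1
    rwa [mul_one] at this
  obtain ⟨g, hg⟩ := exists_dual_div (X.centralMono_ne_zero _ hu) (X.functional s) fun y' => by
    rw [centralMono_dvd_iff]
    intro d hd
    obtain ⟨hd1, hsd, -⟩ := (X.coeff_functional_ne_zero_iff s y' d).1 hd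
    have h1 := hsa (d - s) (by rwa [add_tsub_cancel_of_le hsd])
    rw [Pi.sub_apply, Nat.add_sub_cancel' (hsd j)] at h1
    intro i
    by_cases hi : i = j
    · subst hi
      simpa using h1
    · simp [hi]
  have hne : X.coeff (X.functional s y : A) (s + c) ≠ 0 :=
    (X.coeff_functional_ne_zero_iff s y (s + c)).2
      ⟨hs, le_self_add, by rwa [add_tsub_cancel_left]⟩
  rw [hg y] at hne
  obtain ⟨a, b, ha, hb, hab⟩ := X.exists_of_coeff_mul_ne_zero hne
  have h1 : Pi.single j N = a := by
    change X.coeff (X.mono _) a ≠ 0 at ha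
    rw [coeff_mono] at ha
    by_contra h1
    simp [h1] at ha
  have h2 : t j ≤ b j := (X.centralMono_dvd_iff t ht _).1 (h g) b hb j
  have h3 : N + b j = s j + c j := by
    have := congrFun hab j
    simpa [← h1] using this
  change t j ≤ c j
  omega

theorem eq_zero_of_forall_dual {N : ℕ} (hN0 : 0 < N) (hN : ∀ a, X.commChar a ^ N = 1) {y : A}
    (h : ∀ g : Module.Dual (Subring.center A) A, g y = 0) : y = 0 := by
  by_contra hy
  obtain ⟨c, hc⟩ := X.exists_coeff_ne_zero hy
  refine (X.coeff_functional_ne_zero_iff ((N - 1) • c) y ((N - 1) • c + c)).2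
    ⟨?_, le_self_add, by rwa [add_tsub_cancel_left]⟩ ?_
  · rw [← succ_nsmul, Nat.sub_add_cancel hN0, commChar_nsmul, hN]
  · rw [h]
    exact X.coeff_zero _

/-- Every monomial is a central monomial times one with exponents at most `N`. -/
theorem finite_center {N : ℕ} (hN0 : 0 < N) (hN : ∀ a, X.commChar a ^ N = 1) :
    Module.Finite (Subring.center A) A := by
  classical
  refine ⟨(Finset.Icc (0 : Fin n → ℕ) (fun _ => N)).image X.mono, eq_top_iff.2 fun y _ => ?_⟩
  refine X.mem_of_mono_mem ((Submodule.span (Subring.center A) _).restrictScalars k) fun c _ => ?_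
  have h1 : N • (fun i => c i / N) + (fun i => c i % N) = c := by
    funext i
    simp [Nat.div_add_mod]
  have h2 : X.mono (fun i => c i % N) ∈ Submodule.span (Subring.center A)
      (((Finset.Icc (0 : Fin n → ℕ) (fun _ => N)).image X.mono : Finset A) : Set A) :=
    Submodule.subset_span (Finset.mem_coe.2 (Finset.mem_image_of_mem _
      (Finset.mem_Icc.2 ⟨zero_le, fun i => (Nat.mod_lt _ hN0).le⟩)))
  rw [← h1, mono_add]
  exact Submodule.smul_of_tower_mem _ _ (Submodule.smul_mem _
    (X.centralMono (N • fun i => c i / N) (by rw [commChar_nsmul, hN])) h2)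

/-- A common denominator for the coordinates of the elements of `A` in a family of monomials that
represent the classes modulo the central monomials. -/
theorem exists_dual_basis {N : ℕ} (hN0 : 0 < N) (hN : ∀ a, X.commChar a ^ N = 1) :
    ∃ (t : Fin n → ℕ) (ht : X.commChar t = 1) (K : Finset ((Fin n → ℕ) → kˣ))
      (h : ((Fin n → ℕ) → kˣ) → Module.Dual (Subring.center A) A)
      (e : ((Fin n → ℕ) → kˣ) → A), ∀ y, X.centralMono t ht • y = ∑ κ ∈ K, h κ y • e κ := by
  classical
  let B := Finset.Icc (0 : Fin n → ℕ) (fun _ => N)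
  have hr : ∀ κ : (Fin n → ℕ) → kˣ, ∃ r : Fin n → ℕ, κ ∈ B.image X.commChar →
      r ∈ B ∧ X.commChar r = κ := by
    intro κ
    by_cases hκ : κ ∈ B.image X.commChar
    · obtain ⟨r, hr⟩ := Finset.mem_image.1 hκ
      exact ⟨r, fun _ => hr⟩
    · exact ⟨0, fun h => absurd h hκ⟩
  choose r hr using hr
  have hcN : ∀ a, X.commChar (N • a) = 1 := fun a => by rw [commChar_nsmul, hN]
  let T : Fin n → ℕ := N • fun _ => N
  let z : ((Fin n → ℕ) → kˣ) → Subring.center A := fun κ =>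
    algebraMap k _ (((X.twist (r κ) ((N - 1) • r κ) *
      X.twist (N • ((fun _ => N) - r κ)) (N • r κ))⁻¹ : kˣ) : k) *
      X.centralMono (N • ((fun _ => N) - r κ)) (hcN _)
  refine ⟨T, hcN _, B.image X.commChar, fun κ => z κ • X.functional ((N - 1) • r κ),
    fun κ => X.mono (r κ), fun y => ?_⟩
  let f : A →ₗ[Subring.center A] A := LinearMap.lsmul _ A (X.centralMono T (hcN _))
  let g : A →ₗ[Subring.center A] A := ∑ κ ∈ B.image X.commChar,
    (z κ • X.functional ((N - 1) • r κ)).smulRight (X.mono (r κ))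
  have hfg : f = g := by
    refine X.center_linearMap_ext fun a => ?_
    have hmem : X.commChar a ∈ B.image X.commChar := by
      refine Finset.mem_image.2 ⟨fun i => a i % N,
        Finset.mem_Icc.2 ⟨zero_le, fun i => (Nat.mod_lt _ hN0).le⟩, ?_⟩
      have h1 : N • (fun i => a i / N) + (fun i => a i % N) = a := by
        funext i
        simp [Nat.div_add_mod]
      conv_rhs => rw [← h1, commChar_add, hcN, one_mul]
    simp only [g, LinearMap.sum_apply, LinearMap.smulRight_apply, LinearMap.smul_apply]
    rw [Finset.sum_eq_single (X.commChar a)]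
    · obtain ⟨hrB, hra⟩ := hr _ hmem
      set ρ := r (X.commChar a) with hρ
      have hρN : (N - 1) • ρ + ρ = N • ρ := by rw [← succ_nsmul, Nat.sub_add_cancel hN0]
      have hρN' : ρ + (N - 1) • ρ = N • ρ := by rw [add_comm, hρN]
      have hT : N • ((fun _ => N) - ρ) + N • ρ = T := by
        rw [← smul_add, tsub_add_cancel_of_le (Finset.mem_Icc.1 hrB).2]
      have hc : X.commChar ((N - 1) • ρ + a) = 1 := by
        rw [commChar_add, ← hra, ← commChar_add, hρN, hcN]
      have h1 : X.functional ((N - 1) • ρ) (X.mono a) • X.mono ρ =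
          X.mono ρ * (X.mono ((N - 1) • ρ) * X.mono a) := by
        have h2 : (X.functional ((N - 1) • ρ) (X.mono a) : A) =
            X.mono ((N - 1) • ρ) * X.mono a := by
          refine X.projAux_of_mem_center ?_
          change X.mono ((N - 1) • ρ) * X.mono a ∈ Subring.center A
          rw [mono_mul]
          exact (Subalgebra.center k A).smul_mem ((X.mono_mem_center_iff _).2 hc) _
        rw [← h2]
        exact (Subring.mem_center_iff.1 (Subtype.prop _) _).symm
      rw [smul_assoc, h1, ← mul_assoc, mono_mul, hρN']
      change X.mono T * X.mono a = algebraMap k A ((X.twist ρ ((N - 1) • ρ) *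
        X.twist (N • ((fun _ => N) - ρ)) (N • ρ))⁻¹ : kˣ) * X.mono (N • ((fun _ => N) - ρ)) *
        ((X.twist ρ ((N - 1) • ρ) : k) • X.mono (N • ρ) * X.mono a)
      rw [← Algebra.smul_def, smul_mul_assoc, smul_mul_assoc, mul_smul_comm, ← mul_assoc,
        X.mono_mul (N • ((fun _ => N) - ρ)) (N • ρ), hT, smul_mul_assoc, smul_smul, smul_smul, ← Units.val_mul, ← Units.val_mul]
      simp [mul_assoc]
    · intro κ hκ hne
      have hc : X.commChar ((N - 1) • r κ + a) ≠ 1 := by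
        intro h
        apply hne
        have h2 : X.commChar (r κ) * X.commChar ((N - 1) • r κ + a) = X.commChar (r κ) * 1 := by
          rw [h]
        rw [commChar_add, ← mul_assoc, ← commChar_add, add_comm (r κ), ← succ_nsmul,
          Nat.sub_add_cancel hN0, hcN, one_mul, mul_one, (hr κ hκ).2] at h2
        exact h2.symm
      have h1 : X.functional ((N - 1) • r κ) (X.mono a) = 0 := by
        rw [functional_apply, mono_mul, ← algebraMap_smul (Subring.center A), map_smul,
          X.proj_mono_of_ne_one hc, smul_zero]
      rw [h1, smul_zero, zero_smul]
    · intro h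
      exact absurd hmem h
  have := LinearMap.congr_fun hfg y
  simpa [f, g] using this

theorem isReflexive_center {N : ℕ} (hN0 : 0 < N) (hN : ∀ a, X.commChar a ^ N = 1) :
    Module.IsReflexive (Subring.center A) A := by
  have := X.isDomain_center
  obtain ⟨t, ht, K, h, e, hy⟩ := X.exists_dual_basis hN0 hN
  refine isReflexive_of_denominator (X.centralMono_ne_zero t ht)
    (fun y => X.eq_zero_of_forall_dual hN0 hN) (fun Φ => ⟨∑ κ ∈ K, Φ (h κ) • e κ, fun g => ?_⟩)
    (fun y hdvd => ?_)
  · have h1 : X.centralMono t ht • g = ∑ κ ∈ K, g (e κ) • h κ := by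
      refine LinearMap.ext fun y => ?_
      rw [LinearMap.smul_apply, ← map_smul, hy, map_sum, LinearMap.sum_apply]
      refine Finset.sum_congr rfl fun κ _ => ?_
      rw [map_smul, LinearMap.smul_apply, smul_eq_mul, smul_eq_mul, mul_comm]
    rw [← smul_eq_mul, ← map_smul, h1, map_sum, map_sum]
    refine Finset.sum_congr rfl fun κ _ => ?_
    rw [map_smul, map_smul, smul_eq_mul, smul_eq_mul, mul_comm]
  · exact (X.exists_eq_mono_mul_iff t y).2 fun c hc => X.le_of_forall_dvd hN0 hN ht hdvd hc

end MonomialBasis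

section Trace

variable (R B : Type*) [CommRing R] [Ring B] [Algebra R B]

/-- The regular trace as a linear map. -/
noncomputable def regularTraceLinear : B →ₗ[R] FractionRing R :=
  (LinearMap.trace (FractionRing R) (FractionRing R ⊗[R] B)).restrictScalars R ∘ₗ
    (Algebra.lmul (FractionRing R) (FractionRing R ⊗[R] B)).toLinearMap.restrictScalars R ∘ₗ
      TensorProduct.mk R (FractionRing R) B 1

theorem regularTraceLinear_apply (b : B) : regularTraceLinear R B b = regularTrace R B b := rfl

variable {R B}

theorem regularTrace_mul_comm (b b' : B) :
    regularTrace R B (b * b') = regularTrace R B (b' * b) := by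
  have h : ∀ b b' : B, regularTrace R B (b * b') =
      LinearMap.trace (FractionRing R) (FractionRing R ⊗[R] B)
        (LinearMap.mulLeft _ (1 ⊗ₜ b) * LinearMap.mulLeft _ (1 ⊗ₜ b')) := fun b b' => by
    rw [regularTrace, Module.End.mul_eq_comp, ← LinearMap.mulLeft_mul,
      Algebra.TensorProduct.tmul_mul_tmul, one_mul]
  rw [h, h, LinearMap.trace_mul_comm]

theorem regularTrace_one [IsDomain R] [Module.Finite R B] :
    regularTrace R B 1 = (genericRank R B : FractionRing R) := by
  rw [regularTrace, ← Algebra.TensorProduct.one_def, LinearMap.mulLeft_one, LinearMap.trace_id,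
    genericRank]

end Trace

namespace MonomialBasis

variable {k A : Type*} [Field k] [Ring A] [Algebra k A] {n : ℕ} (X : MonomialBasis k A n)

/-- The ideals of the center that are spanned by monomials. -/
def IsMonomialIdeal (I : Ideal (Subring.center A)) : Prop :=
  ∀ z ∈ I, ∀ (c : Fin n → ℕ) (hc : X.commChar c = 1), X.coeff (z : A) c ≠ 0 →
    X.centralMono c hc ∈ I

variable {X}

theorem centralMono_mem_of_add {I : Ideal (Subring.center A)} {a b c : Fin n → ℕ}
    (ha : X.commChar a = 1) (hb : X.commChar b = 1) (hc : X.commChar c = 1) (hab : a + b = c)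
    (h : X.centralMono a ha * X.centralMono b hb ∈ I) : X.centralMono c hc ∈ I := by
  subst hab
  have : X.centralMono (a + b) hc =
      algebraMap k _ ((X.twist a b)⁻¹ : kˣ) * (X.centralMono a ha * X.centralMono b hb) := by
    refine Subtype.ext ?_
    change X.mono (a + b) = algebraMap k A _ * (X.mono a * X.mono b)
    rw [mono_add, ← Algebra.smul_def, Units.smul_def]
  rw [this]
  exact I.mul_mem_left _ h

theorem IsMonomialIdeal.mul {I J : Ideal (Subring.center A)} (hI : X.IsMonomialIdeal I)
    (hJ : X.IsMonomialIdeal J) : X.IsMonomialIdeal (I * J) := by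
  intro z hz c hc hzc
  induction hz using Submodule.mul_induction_on' with
  | mem_mul_mem y hy y' hy' =>
    obtain ⟨a, b, ha, hb, hab⟩ := X.exists_of_coeff_mul_ne_zero hzc
    have ha1 := X.commChar_eq_one_of_mem_center y.2 ha
    have hb1 := X.commChar_eq_one_of_mem_center y'.2 hb
    exact centralMono_mem_of_add ha1 hb1 hc hab
      (Ideal.mul_mem_mul (hI y hy a ha1 ha) (hJ y' hy' b hb1 hb))
  | add y _ y' _ h h' =>
    by_cases h0 : X.coeff (y : A) c = 0
    · rw [coeff_coe_add, h0, zero_add] at hzc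
      exact h' hzc
    · exact h h0

theorem IsMonomialIdeal.pow {I : Ideal (Subring.center A)} (hI : X.IsMonomialIdeal I) (p : ℕ) :
    X.IsMonomialIdeal (I ^ p) := by
  induction p with
  | zero =>
    rw [pow_zero, Ideal.one_eq_top]
    exact fun _ _ _ _ _ => Submodule.mem_top
  | succ p ih =>
    rw [pow_succ]
    exact ih.mul hI

theorem isMonomialIdeal_span {S : Set (Subring.center A)}
    (hS : ∀ z ∈ S, ∀ (c : Fin n → ℕ) (hc : X.commChar c = 1), X.coeff (z : A) c ≠ 0 →
      X.centralMono c hc ∈ Ideal.span S) : X.IsMonomialIdeal (Ideal.span S) := by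
  intro z hz c hc hzc
  induction hz using Submodule.span_induction generalizing c with
  | mem y hy => exact hS y hy c hc hzc
  | zero => exact absurd (X.coeff_zero c) hzc
  | add y y' _ _ h h' =>
    by_cases h0 : X.coeff (y : A) c = 0
    · rw [coeff_coe_add, h0, zero_add] at hzc
      exact h' c hc hzc
    · exact h c hc h0
  | smul r y _ h =>
    obtain ⟨a, b, ha, hb, hab⟩ := X.exists_of_coeff_mul_ne_zero hzc
    have ha1 := X.commChar_eq_one_of_mem_center r.2 ha
    have hb1 : X.commChar b = 1 := by
      rw [← hab, commChar_add, ha1, one_mul] at hc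
      exact hc
    exact centralMono_mem_of_add ha1 hb1 hc hab (Ideal.mul_mem_left _ _ (h b hb1 hb))

/-- The reflexive hull of the extension of a monomial ideal is generated by the monomial whose
exponent is the coordinatewise minimum of the exponents of the ideal. -/
theorem IsMonomialIdeal.exists_hullGeneratedBy {N : ℕ} (hN0 : 0 < N)
    (hN : ∀ a, X.commChar a ^ N = 1) {I : Ideal (Subring.center A)} (hI : X.IsMonomialIdeal I) :
    ∃ d : A, HullGeneratedBy (Subring.center A) A (extendedIdeal (Subring.center A) A I) d := by
  have := X.isDomain
  have := X.isDomain_center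
  by_cases hbot : I = ⊥
  · refine ⟨0, ?_⟩
    rw [hbot, extendedIdeal, Submodule.bot_smul]
    exact hullGeneratedBy_bot (X.isReflexive_center hN0 hN)
  let E : Set (Fin n → ℕ) := {c | ∃ hc : X.commChar c = 1, X.centralMono c hc ∈ I}
  obtain ⟨z₀, hz₀I, hz₀⟩ := Submodule.exists_mem_ne_zero_of_ne_bot hbot
  obtain ⟨c₀, hc₀⟩ := X.exists_coeff_ne_zero (y := (z₀ : A)) fun h => hz₀ (Subtype.ext h)
  have hc₁ := X.commChar_eq_one_of_mem_center z₀.2 hc₀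
  have hz := hI z₀ hz₀I c₀ hc₁ hc₀
  have hE : c₀ ∈ E := ⟨hc₁, hz⟩
  let m : Fin n → ℕ := fun j => sInf ((fun c => c j) '' E)
  have hm_le : ∀ c ∈ E, m ≤ c := fun c hc j => Nat.sInf_le ⟨c, hc, rfl⟩
  have hm_mem : ∀ j, ∃ c ∈ E, c j = m j := fun j =>
    Nat.sInf_mem (s := (fun c : Fin n → ℕ => c j) '' E) ⟨_, c₀, hE, rfl⟩
  set z := X.centralMono c₀ hc₁ with hzdef
  have hz0 : z ≠ 0 := X.centralMono_ne_zero c₀ hc₁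
  set M := extendedIdeal (Subring.center A) A I with hM
  have hzM : ∀ b : A, z • b ∈ M := fun b => Submodule.smul_mem_smul hz Submodule.mem_top
  have hMle : ∀ y ∈ M, ∃ y', X.mono m * y' = y := by
    intro y hy
    induction hy using Submodule.smul_induction_on' with
    | smul r hr a _ =>
      obtain ⟨y', hy'⟩ := (X.exists_eq_mono_mul_iff m (r : A)).2 fun c hc =>
        have hc1 := X.commChar_eq_one_of_mem_center r.2 hc
        hm_le c ⟨hc1, hI r hr c hc1 hc⟩
      refine ⟨y' * a, ?_⟩
      rw [← mul_assoc, ← hy']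
      rfl
    | add y₁ _ y₂ _ h₁ h₂ =>
      obtain ⟨y₁', rfl⟩ := h₁
      obtain ⟨y₂', rfl⟩ := h₂
      exact ⟨y₁' + y₂', mul_add _ _ _⟩
  refine ⟨X.mono m, bidualInclusion_injective M hz0 hzM, X.isNormalElement_mono m, ?_⟩
  ext b
  rw [mem_reflexiveHull_iff M hz0 hzM]
  constructor
  · intro h
    let e := LinearEquiv.ofInjective (LinearMap.mulLeft (Subring.center A) (X.mono m))
      fun _ _ h => mul_left_cancel₀ (X.mono.ne_zero m) h
    let φ : M →ₗ[Subring.center A] A :=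
      e.symm.toLinearMap ∘ₗ Submodule.inclusion (fun y hy => hMle y hy)
    have hφ : ∀ x : M, X.mono m * φ x = x := fun x =>
      congrArg Subtype.val (e.apply_symm_apply (Submodule.inclusion (fun y hy => hMle y hy) x))
    obtain ⟨y', hy'⟩ := (X.exists_eq_mono_mul_iff c₀ (φ ⟨z • b, hzM b⟩)).2 fun c hc =>
      X.le_of_forall_dvd hN0 hN hc₁ (fun g => h (g ∘ₗ φ)) hc
    refine ⟨y', mul_left_cancel₀ (X.mono.ne_zero c₀) ?_⟩
    have h1 := hφ ⟨z • b, hzM b⟩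
    have h2 : X.mono m * X.mono c₀ = X.mono c₀ * X.mono m := Subring.mem_center_iff.1 z.2 _
    rw [hy', ← mul_assoc, h2, mul_assoc] at h1
    exact h1
  · rintro ⟨a, rfl⟩ f
    rw [centralMono_dvd_iff]
    intro d hd j
    obtain ⟨c, ⟨hc, hcI⟩, hcj⟩ := hm_mem j
    have hu : X.commChar (N • (c - m)) = 1 := by rw [commChar_nsmul, hN]
    have hsum : N • (c - m) + m = c + (N - 1) • (c - m) := by
      obtain ⟨N', rfl⟩ : ∃ N', N = N' + 1 := ⟨N - 1, by omega⟩
      rw [succ_nsmul, add_assoc, tsub_add_cancel_of_le (hm_le c ⟨hc, hcI⟩), add_comm,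
        Nat.add_sub_cancel]
    set b := LinearMap.mulLeft (Subring.center A) (X.mono m) a
    have hub : X.centralMono _ hu • b ∈ M := by
      have : X.centralMono _ hu • b = X.centralMono c hc •
          ((X.twist (N • (c - m)) m : k) • ((X.twist c ((N - 1) • (c - m)))⁻¹ : kˣ) •
            (X.mono ((N - 1) • (c - m)) * a)) := by
        change X.mono (N • (c - m)) * (X.mono m * a) = X.mono c * _
        rw [← mul_assoc, mono_mul, hsum, mono_add, mul_smul_comm, mul_smul_comm, smul_mul_assoc,
          smul_mul_assoc, mul_assoc]
      rw [this]
      exact Submodule.smul_mem_smul hcI Submodule.mem_top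
    have h1 : X.centralMono _ hu * f ⟨z • b, hzM b⟩ = z * f ⟨_, hub⟩ := by
      rw [← smul_eq_mul, ← smul_eq_mul, ← map_smul f, ← map_smul f]
      refine congrArg f ?_
      exact Subtype.ext (smul_comm _ _ _)
    have h2 : X.coeff ((X.centralMono _ hu * f ⟨z • b, hzM b⟩ : Subring.center A) : A)
        (N • (c - m) + d) ≠ 0 := by
      change X.coeff (X.mono (N • (c - m)) * _) _ ≠ 0
      rw [coeff_mono_mul, if_pos le_self_add, add_tsub_cancel_left]
      exact mul_ne_zero (Units.ne_zero _) hd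
    rw [h1] at h2
    have h3 := (X.centralMono_dvd_iff c₀ hc₁ _).1 (Dvd.intro _ rfl) _ h2 j
    simpa [hcj] using h3

variable (X)

theorem regularTrace_mono_of_ne_one {N : ℕ} (hN0 : 0 < N) (hN : ∀ a, X.commChar a ^ N = 1)
    {a : Fin n → ℕ} (ha : X.commChar a ≠ 1) : regularTrace (Subring.center A) A (X.mono a) = 0 := by
  have := X.isDomain
  have := X.isDomain_center
  obtain ⟨c, hc⟩ : ∃ c, X.commChar a c ≠ 1 := by
    by_contra! h
    exact ha (funext h)
  have hcN : X.commChar (N • c) = 1 := by rw [commChar_nsmul, hN]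
  have hsum : (N - 1) • c + c = N • c := by rw [← succ_nsmul, Nat.sub_add_cancel hN0]
  set P := X.mono ((N - 1) • c)
  set Q := X.mono c
  let w : Subring.center A :=
    algebraMap k _ (X.twist ((N - 1) • c) c : k) * X.centralMono (N • c) hcN
  have hw0 : w ≠ 0 := mul_ne_zero
    ((map_ne_zero_iff _ (algebraMap k (Subring.center A)).injective).2 (Units.ne_zero _))
    (X.centralMono_ne_zero _ _)
  have hPQ : P * Q = w := by
    change _ = algebraMap k A _ * X.mono (N • c)
    rw [mono_mul, hsum, Algebra.smul_def]
  have hQP : Q * P = w := by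
    refine mul_right_cancel₀ (X.mono.ne_zero c) ?_
    change Q * P * Q = w * Q
    rw [mul_assoc, hPQ, Subring.mem_center_iff.1 w.2]
  let β := algebraMap k (Subring.center A) (X.commChar a c : k)
  have hβ : β ≠ 1 := by
    rw [← map_one (algebraMap k (Subring.center A))]
    exact fun h => hc (Units.ext ((algebraMap k (Subring.center A)).injective h))
  have hr : X.mono a * Q = β • (Q * X.mono a) := by
    rw [algebraMap_smul, ← mono_comm]
  let tr := regularTraceLinear (Subring.center A) A
  have h1 : tr (P * (X.mono a * Q)) = β • w • tr (X.mono a) := by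
    rw [hr, mul_smul_comm, ← mul_assoc, hPQ, map_smul, ← map_smul tr w]
    rfl
  have h2 : tr (P * (X.mono a * Q)) = w • tr (X.mono a) := by
    have : tr (P * (X.mono a * Q)) = tr (X.mono a * Q * P) := regularTrace_mul_comm _ _
    rw [this, mul_assoc, hQP, Subring.mem_center_iff.1 w.2, ← map_smul tr w]
    rfl
  have h3 : (β - 1) • w • tr (X.mono a) = 0 := by
    rw [sub_smul, ← h1, h2, one_smul, sub_self]
  exact (smul_eq_zero.1 ((smul_eq_zero.1 h3).resolve_left (sub_ne_zero.2 hβ))).resolve_left hw0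

/-- The regular trace is the projection to the center times the rank. -/
theorem regularTrace_eq {N : ℕ} (hN0 : 0 < N) (hN : ∀ a, X.commChar a ^ N = 1)
    (hfin : Module.Finite (Subring.center A) A) (y : A) :
    regularTrace (Subring.center A) A y = algebraMap (Subring.center A) _
      (((genericRank (Subring.center A) A : Subring.center A) • X.proj) y) := by
  have := X.isDomain_center
  have key : regularTraceLinear (Subring.center A) A =
      Algebra.linearMap (Subring.center A) (FractionRing (Subring.center A)) ∘ₗ
        ((genericRank (Subring.center A) A : Subring.center A) • X.proj) := by
    refine X.center_linearMap_ext fun a => ?_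
    by_cases ha : X.commChar a = 1
    · have h1 : X.mono a = X.centralMono a ha • (1 : A) := (mul_one _).symm
      have h2 : X.proj (X.mono a) = X.centralMono a ha :=
        Subtype.ext (X.coe_proj_mono_of_eq_one ha)
      rw [LinearMap.comp_apply, LinearMap.smul_apply, h2, h1, map_smul, regularTraceLinear_apply,
        regularTrace_one, Algebra.linearMap_apply, smul_eq_mul, map_mul, map_natCast,
        Algebra.smul_def, mul_comm]
    · rw [LinearMap.comp_apply, LinearMap.smul_apply, X.proj_mono_of_ne_one ha, smul_zero, map_zero]
      exact X.regularTrace_mono_of_ne_one hN0 hN ha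
  exact LinearMap.congr_fun key y

/-- The discriminant of two families, for a linear functional `τ` in place of the trace. -/
noncomputable def gramDet {v : ℕ} (τ : Module.Dual (Subring.center A) A) (u u' : Fin v → A) :
    Subring.center A :=
  (Matrix.of fun i j => τ (u i * u' j)).det

/-- A property of Gram determinants that is stable under linear combinations over `k` holds for all
families if it holds for families of monomials. -/
theorem gramDet_mem_of_mono {v : ℕ} (τ : Module.Dual (Subring.center A) A)
    (V : Submodule k (Subring.center A))
    (h : ∀ a b : Fin v → Fin n → ℕ, gramDet τ (X.mono ∘ a) (X.mono ∘ b) ∈ V) (u u' : Fin v → A) :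
    gramDet τ u u' ∈ V := by
  let D : MultilinearMap k (fun _ : Fin v => Fin v → Subring.center A) (Subring.center A) :=
    (Matrix.detRowAlternating (n := Fin v) (R := Subring.center A)).toMultilinearMap.restrictScalars k
  let L : (Fin v → A) → A →ₗ[k] (Fin v → Subring.center A) := fun u' =>
    LinearMap.pi fun j => τ.restrictScalars k ∘ₗ LinearMap.mulRight k (u' j)
  let L' : (Fin v → A) → A →ₗ[k] (Fin v → Subring.center A) := fun u =>
    LinearMap.pi fun i => τ.restrictScalars k ∘ₗ LinearMap.mulLeft k (u i)
  have hL : ∀ u u' : Fin v → A, gramDet τ u u' = D.compLinearMap (fun _ => L u') u :=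
    fun u u' => rfl
  have hL' : ∀ u u' : Fin v → A, gramDet τ u u' = D.compLinearMap (fun _ => L' u) u' :=
    fun u u' => (Matrix.det_transpose _).symm
  have h1 : ∀ (a : Fin v → Fin n → ℕ) (u' : Fin v → A), gramDet τ (X.mono ∘ a) u' ∈ V := by
    intro a u'
    have : V.mkQ.compMultilinearMap (D.compLinearMap fun _ => L' (X.mono ∘ a)) = 0 := by
      refine Module.Basis.ext_multilinear (fun _ => X.mono) fun b => ?_
      refine (Submodule.Quotient.mk_eq_zero V).2 ?_
      have := h a b
      rwa [hL'] at this
    rw [hL']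
    exact (Submodule.Quotient.mk_eq_zero V).1 (congrArg (fun f => f u') this)
  have : V.mkQ.compMultilinearMap (D.compLinearMap fun _ => L u') = 0 := by
    refine Module.Basis.ext_multilinear (fun _ => X.mono) fun a => ?_
    refine (Submodule.Quotient.mk_eq_zero V).2 ?_
    have := h1 a u'
    rwa [hL] at this
  rw [hL]
  exact (Submodule.Quotient.mk_eq_zero V).1 (congrArg (fun f => f u) this)

/-- A central element is homogeneous of exponent `s` if no other exponent occurs in it. -/
def IsHomogeneous (z : Subring.center A) (s : Fin n → ℕ) : Prop :=
  ∀ c, X.coeff (z : A) c ≠ 0 → c = s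

variable {X}

theorem IsHomogeneous.mul {z z' : Subring.center A} {s s' : Fin n → ℕ} (h : X.IsHomogeneous z s)
    (h' : X.IsHomogeneous z' s') : X.IsHomogeneous (z * z') (s + s') := by
  intro c hc
  obtain ⟨a, b, ha, hb, rfl⟩ := X.exists_of_coeff_mul_ne_zero hc
  rw [h a ha, h' b hb]

theorem IsHomogeneous.prod {ι : Type*} (t : Finset ι) {z : ι → Subring.center A}
    {s : ι → Fin n → ℕ} (h : ∀ i ∈ t, X.IsHomogeneous (z i) (s i)) :
    X.IsHomogeneous (∏ i ∈ t, z i) (∑ i ∈ t, s i) := by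
  classical
  induction t using Finset.induction_on with
  | empty =>
    intro c hc
    have : ((1 : Subring.center A) : A) = X.mono 0 := X.mono_zero.symm
    rw [Finset.prod_empty, this, coeff_mono] at hc
    rw [Finset.sum_empty]
    by_contra h
    simp [Ne.symm h] at hc
  | insert i t hi ih =>
    rw [Finset.prod_insert hi, Finset.sum_insert hi]
    exact (h i (Finset.mem_insert_self _ _)).mul
      (ih fun j hj => h j (Finset.mem_insert_of_mem hj))

theorem IsHomogeneous.sum {ι : Type*} (t : Finset ι) {z : ι → Subring.center A}
    {s : Fin n → ℕ} (h : ∀ i ∈ t, X.IsHomogeneous (z i) s) :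
    X.IsHomogeneous (∑ i ∈ t, z i) s := by
  refine Finset.sum_induction z (fun z => X.IsHomogeneous z s) (fun z z' hz hz' c hc => ?_)
    (fun c hc => absurd (X.coeff_zero c) hc) h
  by_cases h0 : X.coeff (z : A) c = 0
  · rw [coeff_coe_add, h0, zero_add] at hc
    exact hz' c hc
  · exact hz c h0

theorem IsHomogeneous.centralMono_mem {z : Subring.center A} {s : Fin n → ℕ}
    (h : X.IsHomogeneous z s) {I : Ideal (Subring.center A)} (hz : z ∈ I) {c : Fin n → ℕ}
    (hc : X.commChar c = 1) (hzc : X.coeff (z : A) c ≠ 0) : X.centralMono c hc ∈ I := by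
  have : X.centralMono c hc = algebraMap k _ (X.coeff (z : A) c)⁻¹ * z := by
    refine Subtype.ext (X.ext_coeff fun d => ?_)
    change X.coeff (X.mono c) d = X.coeff (algebraMap k A _ * z) d
    rw [← Algebra.smul_def, coeff_smul, coeff_mono]
    split_ifs with hcd
    · rw [← hcd, inv_mul_cancel₀ hzc]
    · have : X.coeff (z : A) d = 0 := by
        by_contra hd
        exact hcd ((h c hzc).trans (h d hd).symm)
      rw [this, mul_zero]
  rw [this]
  exact I.mul_mem_left _ hz

variable (X)

theorem isHomogeneous_proj_mono_mul (w : Subring.center A) {s : Fin n → ℕ}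
    (hw : X.IsHomogeneous w 0) (a b : Fin n → ℕ) (hs : a + b = s) :
    X.IsHomogeneous ((w • X.proj) (X.mono a * X.mono b)) s := by
  have h1 : X.IsHomogeneous (X.proj (X.mono a * X.mono b)) s := by
    classical
    intro c hc
    rw [coeff_proj, X.mono_mul, coeff_smul, coeff_mono, hs] at hc
    by_contra h
    simp [Ne.symm h] at hc
  have := hw.mul h1
  rwa [zero_add] at this

theorem isHomogeneous_natCast (m : ℕ) : X.IsHomogeneous (m : Subring.center A) 0 := by
  intro c hc
  have : ((m : Subring.center A) : A) = (m : k) • X.mono 0 := by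
    rw [mono_zero, Algebra.smul_def, map_natCast, mul_one]
    rfl
  rw [this, coeff_smul, coeff_mono] at hc
  by_contra h
  simp [Ne.symm h] at hc

theorem isHomogeneous_gramDet_mono {v : ℕ} {w : Subring.center A} (hw : X.IsHomogeneous w 0)
    (a b : Fin v → Fin n → ℕ) :
    X.IsHomogeneous (gramDet (w • X.proj) (X.mono ∘ a) (X.mono ∘ b)) (∑ i, a i + ∑ i, b i) := by
  rw [gramDet, Matrix.det_apply']
  refine IsHomogeneous.sum _ fun σ _ => ?_
  have h1 : X.IsHomogeneous (((Equiv.Perm.sign σ : ℤˣ) : ℤ) : Subring.center A) 0 := by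
    intro c hc
    have : ((((Equiv.Perm.sign σ : ℤˣ) : ℤ) : Subring.center A) : A) =
        (((Equiv.Perm.sign σ : ℤˣ) : ℤ) : k) • X.mono 0 := by
      rw [mono_zero, Algebra.smul_def, map_intCast, mul_one]
      rfl
    rw [this, coeff_smul, coeff_mono] at hc
    by_contra h
    simp [Ne.symm h] at hc
  have h2 := h1.mul (IsHomogeneous.prod Finset.univ (s := fun i => a (σ i) + b i) fun i _ =>
    X.isHomogeneous_proj_mono_mul w hw (a (σ i)) (b i) rfl)
  rwa [zero_add, Finset.sum_add_distrib, Equiv.sum_comp σ a] at h2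

theorem isMonomialIdeal_modifiedDiscriminantIdeal {N : ℕ} (hN0 : 0 < N)
    (hN : ∀ a, X.commChar a ^ N = 1) (v : ℕ) :
    X.IsMonomialIdeal (modifiedDiscriminantIdeal (Subring.center A) A v) := by
  have := X.isDomain_center
  have hfin := X.finite_center hN0 hN
  let w : Subring.center A := (genericRank (Subring.center A) A : Subring.center A)
  have hdet : ∀ u u' : Fin v → A,
      (Matrix.of fun i j => regularTrace (Subring.center A) A (u i * u' j)).det =
        algebraMap (Subring.center A) _ (gramDet (w • X.proj) u u') := by
    intro u u'
    rw [gramDet, RingHom.map_det]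
    congr 1
    ext i j
    exact X.regularTrace_eq hN0 hN hfin _
  set I := modifiedDiscriminantIdeal (Subring.center A) A v with hI
  let V : Submodule k (Subring.center A) :=
    { carrier := {z | ∀ (c : Fin n → ℕ) (hc : X.commChar c = 1), X.coeff (z : A) c ≠ 0 →
        X.centralMono c hc ∈ I}
      add_mem' := fun {z z'} hz hz' c hc h => by
        by_cases h0 : X.coeff (z : A) c = 0
        · rw [coeff_coe_add, h0, zero_add] at h
          exact hz' c hc h
        · exact hz c hc h0
      zero_mem' := fun c hc h => absurd (X.coeff_zero c) h
      smul_mem' := fun r z hz c hc h => by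
        refine hz c hc fun h0 => h ?_
        have : ((r • z : Subring.center A) : A) = r • (z : A) := by
          rw [Algebra.smul_def, Algebra.smul_def]
          rfl
        rw [this, coeff_smul, h0, mul_zero] }
  refine isMonomialIdeal_span ?_
  rintro z ⟨u, u', -, -, hz⟩ c hc hzc
  rw [hdet] at hz
  have hz' := IsFractionRing.injective (Subring.center A) (FractionRing (Subring.center A)) hz
  refine X.gramDet_mem_of_mono (w • X.proj) V (fun a b => ?_) u u' c hc (hz' ▸ hzc)
  by_cases ha : Function.Injective a
  · by_cases hb : Function.Injective b
    · intro c hc h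
      refine (X.isHomogeneous_gramDet_mono (X.isHomogeneous_natCast _) a b).centralMono_mem
        (Ideal.subset_span ?_) hc h
      exact ⟨X.mono ∘ a, X.mono ∘ b, X.mono.injective.comp ha, X.mono.injective.comp hb,
        (hdet _ _).symm⟩
    · obtain ⟨i, j, hij, hne⟩ := Function.not_injective_iff.1 hb
      have : gramDet (w • X.proj) (X.mono ∘ a) (X.mono ∘ b) = 0 :=
        Matrix.det_zero_of_column_eq hne fun l => by simp [hij]
      rw [this]
      exact V.zero_mem
  · obtain ⟨i, j, hij, hne⟩ := Function.not_injective_iff.1 ha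
    have : gramDet (w • X.proj) (X.mono ∘ a) (X.mono ∘ b) = 0 :=
      Matrix.det_zero_of_row_eq hne (by funext l; simp [hij])
    rw [this]
    exact V.zero_mem

theorem discriminantHypothesis {N : ℕ} (hN0 : 0 < N) (hN : ∀ a, X.commChar a ^ N = 1) :
    DiscriminantHypothesis (Subring.center A) A where
  algebraMap_injective := Subtype.val_injective
  prime := by
    have := X.isDomain
    refine ⟨inferInstance, fun a b h => ?_⟩
    have := h 1
    rwa [mul_one, mul_eq_zero] at this
  finite := X.finite_center hN0 hN
  trace_mem b := ⟨_, (X.regularTrace_eq hN0 hN (X.finite_center hN0 hN) b).symm⟩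

theorem commChar_symm (a c : Fin n → ℕ) : X.commChar a c = (X.commChar c a)⁻¹ := by
  rw [commChar, commChar, inv_div]

theorem commChar_sum {ι : Type*} (t : Finset ι) (a : ι → Fin n → ℕ) :
    X.commChar (∑ i ∈ t, a i) = ∏ i ∈ t, X.commChar (a i) := by
  classical
  induction t using Finset.induction_on with
  | empty => exact X.commChar_zero
  | insert i t hi ih => rw [Finset.sum_insert hi, Finset.prod_insert hi, commChar_add, ih]

theorem commChar_pow_eq_one_of_generators {N : ℕ} {c : Fin n → ℕ}
    (h : ∀ i, X.commChar (Pi.single i 1) c ^ N = 1) (a : Fin n → ℕ) : X.commChar a c ^ N = 1 := by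
  have ha : a = ∑ i, a i • (Pi.single i 1 : Fin n → ℕ) := by
    funext j
    simp [Finset.sum_apply, Pi.single_apply]
  rw [ha, commChar_sum, Finset.prod_apply, ← Finset.prod_pow]
  refine Finset.prod_eq_one fun i _ => ?_
  rw [commChar_nsmul, Pi.pow_apply, pow_right_comm, h, one_pow]

theorem commChar_pow_eq_one {N : ℕ}
    (h : ∀ i j, X.commChar (Pi.single i 1) (Pi.single j 1) ^ N = 1) (a : Fin n → ℕ) :
    X.commChar a ^ N = 1 := by
  funext c
  refine X.commChar_pow_eq_one_of_generators (fun i => ?_) a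
  rw [commChar_symm, inv_pow, X.commChar_pow_eq_one_of_generators (fun j => h j i), inv_one]

end MonomialBasis

section Basis

variable {k : Type*} [Field k] {n : ℕ} (q : Fin n → Fin n → kˣ)

/-- The projection from the free algebra. -/
noncomputable def toSkew : FreeAlgebra k (Fin n) →ₐ[k] SkewPolynomialRing q :=
  RingQuot.mkAlgHom k (SkewRel q)

/-- The generators of the skew polynomial ring. -/
noncomputable def gen (i : Fin n) : SkewPolynomialRing q :=
  toSkew q (FreeAlgebra.ι k i)

theorem gen_mul_gen_of_lt {i j : Fin n} (hij : i < j) :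
    gen q j * gen q i = (q i j : k) • (gen q i * gen q j) := by
  have := RingQuot.mkAlgHom_rel k (SkewRel.rel (q := q) i j hij)
  rw [map_mul, map_smul, map_mul] at this
  exact this

theorem gen_mul_gen (hdiag : ∀ i, q i i = 1) (hanti : ∀ i j, q i j = (q j i)⁻¹) (i j : Fin n) :
    gen q j * gen q i = (q i j : k) • (gen q i * gen q j) := by
  rcases lt_trichotomy i j with h | rfl | h
  · exact gen_mul_gen_of_lt q h
  · rw [hdiag, Units.val_one, one_smul]
  · rw [gen_mul_gen_of_lt q h, smul_smul, ← Units.val_mul, hanti i j, inv_mul_cancel, Units.val_one,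
      one_smul]

/-- The product of the generators along a word. -/
noncomputable def wordProd (w : List (Fin n)) : SkewPolynomialRing q := (w.map (gen q)).prod

theorem wordProd_cons (i : Fin n) (w : List (Fin n)) :
    wordProd q (i :: w) = gen q i * wordProd q w := by
  simp [wordProd]

theorem wordProd_append (w w' : List (Fin n)) :
    wordProd q (w ++ w') = wordProd q w * wordProd q w' := by
  simp [wordProd]

theorem exists_wordProd_eq_smul (hdiag : ∀ i, q i i = 1) (hanti : ∀ i j, q i j = (q j i)⁻¹)
    {w w' : List (Fin n)} (h : w.Perm w') : ∃ u : kˣ, wordProd q w = (u : k) • wordProd q w' := by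
  induction h with
  | nil => exact ⟨1, by simp⟩
  | cons i _ ih =>
    obtain ⟨u, hu⟩ := ih
    exact ⟨u, by rw [wordProd_cons, wordProd_cons, hu, mul_smul_comm]⟩
  | swap i j w =>
    refine ⟨q i j, ?_⟩
    simp only [wordProd_cons]
    rw [← mul_assoc, gen_mul_gen q hdiag hanti i j, smul_mul_assoc, mul_assoc]
  | trans _ _ ih ih' =>
    obtain ⟨u, hu⟩ := ih
    obtain ⟨u', hu'⟩ := ih'
    exact ⟨u * u', by rw [hu, hu', smul_smul, Units.val_mul]⟩

/-- The exponent of a word. -/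
def wordExponent (w : List (Fin n)) (i : Fin n) : ℕ := w.count i

theorem wordExponent_cons (i : Fin n) (w : List (Fin n)) :
    wordExponent (i :: w) = wordExponent w + Pi.single i 1 := by
  funext j
  simp only [wordExponent, List.count_cons, Pi.add_apply, Pi.single_apply]
  by_cases h : i = j
  · simp [h]
  · simp [h, Ne.symm h]

theorem wordExponent_append (w w' : List (Fin n)) :
    wordExponent (w ++ w') = wordExponent w + wordExponent w' := by
  funext j
  simp [wordExponent]

theorem wordExponent_surjective : Function.Surjective (wordExponent (n := n)) := by
  intro a
  refine ⟨(List.finRange n).flatMap fun i => List.replicate (a i) i, ?_⟩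
  funext j
  simp only [wordExponent, List.count_flatMap]
  have : (List.count j ∘ fun i => List.replicate (a i) i) = fun i => if i = j then a i else 0 := by
    funext i
    simp [List.count_replicate]
  rw [this, ← List.ofFn_eq_map, List.sum_ofFn]
  simp

/-- A word with a given exponent. -/
noncomputable def word (a : Fin n → ℕ) : List (Fin n) := (wordExponent_surjective a).choose

theorem wordExponent_word (a : Fin n → ℕ) : wordExponent (word a) = a :=
  (wordExponent_surjective a).choose_spec

theorem perm_of_wordExponent_eq {w w' : List (Fin n)} (h : wordExponent w = wordExponent w') :
    w.Perm w' :=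
  List.perm_iff_count.2 fun i => congrFun h i

/-- The monomial with a given exponent, up to a unit of `k`. -/
noncomputable def monomial (a : Fin n → ℕ) : SkewPolynomialRing q := wordProd q (word a)

theorem monomial_zero : monomial q 0 = 1 := by
  have : (word (0 : Fin n → ℕ)) = [] := by
    rw [← List.perm_nil]
    exact perm_of_wordExponent_eq (by rw [wordExponent_word]; funext i; simp [wordExponent])
  simp [monomial, this, wordProd]

section

variable (hdiag : ∀ i, q i i = 1) (hanti : ∀ i j, q i j = (q j i)⁻¹)

include hdiag hanti

theorem exists_monomial_mul (a b : Fin n → ℕ) :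
    ∃ u : kˣ, monomial q a * monomial q b = (u : k) • monomial q (a + b) := by
  rw [monomial, monomial, ← wordProd_append]
  refine exists_wordProd_eq_smul q hdiag hanti (perm_of_wordExponent_eq ?_)
  rw [wordExponent_append, wordExponent_word, wordExponent_word, wordExponent_word]

theorem exists_gen_mul_monomial (i : Fin n) (a : Fin n → ℕ) :
    ∃ u : kˣ, gen q i * monomial q a = (u : k) • monomial q (a + Pi.single i 1) := by
  rw [monomial, ← wordProd_cons]
  refine exists_wordProd_eq_smul q hdiag hanti (perm_of_wordExponent_eq ?_)
  rw [wordExponent_cons, wordExponent_word, wordExponent_word]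

theorem span_monomial : Submodule.span k (Set.range (monomial q)) = ⊤ := by
  set S := Submodule.span k (Set.range (monomial q)) with hS
  have key : ∀ (f : FreeAlgebra k (Fin n)), ∀ y ∈ S, toSkew q f * y ∈ S := by
    intro f
    induction f using FreeAlgebra.induction with
    | grade0 r =>
      intro y hy
      rw [AlgHom.commutes, ← Algebra.smul_def]
      exact S.smul_mem _ hy
    | grade1 i =>
      intro y hy
      induction hy using Submodule.span_induction with
      | mem y hy =>
        obtain ⟨a, rfl⟩ := hy
        obtain ⟨u, hu⟩ := exists_gen_mul_monomial q hdiag hanti i a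
        have : toSkew q (FreeAlgebra.ι k i) * monomial q a = _ := hu
        rw [this]
        exact S.smul_mem _ (Submodule.subset_span ⟨_, rfl⟩)
      | zero => rw [mul_zero]; exact S.zero_mem
      | add y y' _ _ h h' => rw [mul_add]; exact S.add_mem h h'
      | smul r y _ h => rw [mul_smul_comm]; exact S.smul_mem _ h
    | mul f g hf hg =>
      intro y hy
      rw [map_mul, mul_assoc]
      exact hf _ (hg _ hy)
    | add f g hf hg =>
      intro y hy
      rw [map_add, add_mul]
      exact S.add_mem (hf _ hy) (hg _ hy)
  refine eq_top_iff.2 fun y _ => ?_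
  obtain ⟨f, rfl⟩ := RingQuot.mkAlgHom_surjective k (SkewRel q) y
  have := key f 1 (Submodule.subset_span ⟨0, monomial_zero q⟩)
  rwa [mul_one] at this

end

/-- The scalar that appears when `x_i` is moved into place in the ordered monomial `x^a`. -/
def reorder (i : Fin n) (a : Fin n → ℕ) : kˣ := ∏ l ∈ Finset.univ.filter (· < i), q l i ^ a l

/-- Left multiplication by `x_i` on ordered monomials. -/
noncomputable def shiftOp (i : Fin n) : Module.End k ((Fin n → ℕ) →₀ k) :=
  Finsupp.linearCombination k fun a => Finsupp.single (a + Pi.single i 1) (reorder q i a : k)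

theorem shiftOp_single (i : Fin n) (a : Fin n → ℕ) (r : k) :
    shiftOp q i (Finsupp.single a r) =
      Finsupp.single (a + Pi.single i 1) (r * (reorder q i a : k)) := by
  simp [shiftOp]

theorem reorder_add_single (i j : Fin n) (a : Fin n → ℕ) :
    reorder q i (a + Pi.single j 1) = reorder q i a * if j < i then q j i else 1 := by
  simp only [reorder, Pi.add_apply, pow_add, Finset.prod_mul_distrib]
  congr 1
  split_ifs with h
  · rw [Finset.prod_eq_single j]
    · simp
    · intro l _ hl
      simp [hl]
    · intro hj
      simp [h] at hj
  · refine Finset.prod_eq_one fun l hl => ?_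
    have : l ≠ j := by
      rintro rfl
      exact h (Finset.mem_filter.1 hl).2
    simp [this]

/-- The regular representation, on ordered monomials. -/
noncomputable def rep : SkewPolynomialRing q →ₐ[k] Module.End k ((Fin n → ℕ) →₀ k) :=
  RingQuot.liftAlgHom k ⟨FreeAlgebra.lift k (shiftOp q), by
    rintro _ _ ⟨i, j, hij⟩
    rw [map_mul, map_smul, map_mul, FreeAlgebra.lift_ι_apply, FreeAlgebra.lift_ι_apply]
    refine Finsupp.lhom_ext fun a r => ?_
    simp only [Module.End.mul_apply, LinearMap.smul_apply, shiftOp_single, reorder_add_single,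
      if_pos hij, if_neg hij.asymm, Finsupp.smul_single]
    rw [add_right_comm]
    congr 1
    simp
    ring⟩

theorem rep_gen (i : Fin n) : rep q (gen q i) = shiftOp q i := by
  have : rep q (gen q i) = FreeAlgebra.lift k (shiftOp q) (FreeAlgebra.ι k i) :=
    RingQuot.liftAlgHom_mkAlgHom_apply _ _ _ _
  rw [this, FreeAlgebra.lift_ι_apply]

theorem rep_wordProd (w : List (Fin n)) :
    ∃ u : kˣ, rep q (wordProd q w) (Finsupp.single 0 1) = Finsupp.single (wordExponent w) (u : k) := by
  induction w with
  | nil =>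
    refine ⟨1, ?_⟩
    have : wordExponent ([] : List (Fin n)) = 0 := by funext i; simp [wordExponent]
    simp [wordProd, this]
  | cons i w ih =>
    obtain ⟨u, hu⟩ := ih
    refine ⟨u * reorder q i (wordExponent w), ?_⟩
    rw [wordProd_cons, map_mul, Module.End.mul_apply, hu, rep_gen, shiftOp_single,
      wordExponent_cons, Units.val_mul]

theorem linearIndependent_monomial : LinearIndependent k (monomial q) := by
  choose u hu using rep_wordProd q
  let f : SkewPolynomialRing q →ₗ[k] ((Fin n → ℕ) →₀ k) :=
    LinearMap.applyₗ (Finsupp.single 0 1) ∘ₗ (rep q).toLinearMap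
  refine LinearIndependent.of_comp f ?_
  have : f ∘ monomial q =
      (fun a => u (word a)) • fun a : Fin n → ℕ => (Finsupp.single a 1 : (Fin n → ℕ) →₀ k) := by
    funext a
    have h1 : f (monomial q a) = _ := hu (word a)
    rw [wordExponent_word] at h1
    rw [Function.comp_apply, h1]
    simp [Units.smul_def]
  rw [this]
  exact (Finsupp.basisSingleOne.linearIndependent (R := k)).units_smul _

/-- The monomial basis of a skew polynomial ring. -/
noncomputable def monomialBasis (hdiag : ∀ i, q i i = 1) (hanti : ∀ i j, q i j = (q j i)⁻¹) :
    MonomialBasis k (SkewPolynomialRing q) n where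
  mono := Module.Basis.mk (linearIndependent_monomial q) (span_monomial q hdiag hanti).ge
  twist a b := (exists_monomial_mul q hdiag hanti a b).choose
  mono_mul a b := by
    simp only [Module.Basis.mk_apply]
    exact (exists_monomial_mul q hdiag hanti a b).choose_spec
  mono_zero := by rw [Module.Basis.mk_apply, monomial_zero]

end Basis

variable {k : Type*} [Field k] {n : ℕ} (q : Fin n → Fin n → kˣ)

theorem exists_monomial_single (hdiag : ∀ i, q i i = 1) (hanti : ∀ i j, q i j = (q j i)⁻¹)
    (i : Fin n) : ∃ u : kˣ, monomial q (Pi.single i 1) = (u : k) • gen q i := by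
  have h : wordExponent [i] = Pi.single i 1 := by
    rw [wordExponent_cons]
    funext j
    simp [wordExponent]
  obtain ⟨u, hu⟩ := exists_wordProd_eq_smul q hdiag hanti
    (perm_of_wordExponent_eq ((wordExponent_word (Pi.single i 1)).trans h.symm))
  exact ⟨u, by rw [monomial, hu]; simp [wordProd]⟩

theorem commChar_monomialBasis_single (hdiag : ∀ i, q i i = 1)
    (hanti : ∀ i j, q i j = (q j i)⁻¹) (i j : Fin n) :
    (monomialBasis q hdiag hanti).commChar (Pi.single j 1) (Pi.single i 1) = q i j := by
  refine Units.ext (MonomialBasis.commChar_eq_of_mono_comm _ ?_)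
  have h : ∀ i, ∃ u : kˣ, (monomialBasis q hdiag hanti).mono (Pi.single i 1) = (u : k) • gen q i := by
    intro i
    obtain ⟨u, hu⟩ := exists_monomial_single q hdiag hanti i
    exact ⟨u, by rw [← hu, monomialBasis, Module.Basis.mk_apply]⟩
  obtain ⟨u, hu⟩ := h i
  obtain ⟨u', hu'⟩ := h j
  rw [hu, hu']
  simp only [smul_mul_assoc, mul_smul_comm]
  rw [gen_mul_gen q hdiag hanti i j]
  simp only [smul_smul]
  congr 1
  ring

theorem exists_commChar_pow_eq_one (hdiag : ∀ i, q i i = 1) (hanti : ∀ i j, q i j = (q j i)⁻¹)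
    (hroot : ∀ i j, IsOfFinOrder (q i j)) :
    ∃ N : ℕ, 0 < N ∧ ∀ a, (monomialBasis q hdiag hanti).commChar a ^ N = 1 := by
  refine ⟨∏ x : Fin n × Fin n, orderOf (q x.1 x.2), Finset.prod_pos fun x _ =>
    (hroot _ _).orderOf_pos, MonomialBasis.commChar_pow_eq_one _ fun j i => ?_⟩
  rw [commChar_monomialBasis_single]
  exact orderOf_dvd_iff_pow_eq_one.1 (Finset.dvd_prod_of_mem
    (fun x : Fin n × Fin n => orderOf (q x.1 x.2)) (Finset.mem_univ (i, j)))

end SkewDisc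

theorem theorem4p6 {k : Type*} [Field k] (n : ℕ) (hn : 2 ≤ n)
    (q : Fin n → Fin n → kˣ)
    (hdiag : ∀ i, q i i = 1)
    (hanti : ∀ i j, q i j = (q j i)⁻¹)
    (hroot : ∀ i j, IsOfFinOrder (q i j)) :
    let A := SkewDisc.SkewPolynomialRing q
    let Z := Subring.center A
    SkewDisc.DiscriminantHypothesis Z A ∧
    Module.IsReflexive Z A ∧
    (∀ p v : ℕ, 0 < p → 0 < v →
      ∃ d : A, SkewDisc.IsPowerExtendedReflexiveHullDiscriminant Z A p v d) ∧
    (∃ d : A, SkewDisc.IsExtendedReflexiveHullDiscriminant Z A d) := by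
  intro A Z
  obtain ⟨N, hN0, hN⟩ := SkewDisc.exists_commChar_pow_eq_one q hdiag hanti hroot
  let X := SkewDisc.monomialBasis q hdiag hanti
  have hMD := X.isMonomialIdeal_modifiedDiscriminantIdeal hN0 hN
  exact ⟨X.discriminantHypothesis hN0 hN, X.isReflexive_center hN0 hN,
    fun p v _ _ => ((hMD v).pow p).exists_hullGeneratedBy hN0 hN,
    (hMD _).exists_hullGeneratedBy hN0 hN⟩
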